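/- For $n\ge 1$ let $\Phi_n(z)=\prod_{1\le k\le n,\ \gcd(k,n)=1}\bigl(z-e^{2\pi i k/n}\bigr)$ be the $n$-th cyclotomic polynomial, let $\hat\Phi_n(z)=\prod_{1\le k\le n,\ \gcd(k,n)=1}\bigl(1-z\,e^{2\pi i k/n}\bigr)$ (so $\hat\Phi_1(z)=1-z$ and $\hat\Phi_n=\Phi_n$ for $n\ge 2$), and let $c_n(m)=\sum_{1\le k\le n,\ \gcd(k,n)=1}e^{2\pi i k m/n}$ be the Ramanujan sum. On the open unit disk let $\log\hat\Phi_n$ denote the holomorphic logarithm of $\hat\Phi_n$ that vanishes at $0$, that is, $\log\hat\Phi_n(z)=\sum_{1\le k\le n,\ \gcd(k,n)=1}\operatorname{Log}\bigl(1-z\,e^{2\pi i k/n}\bigr)$ with $\operatorname{Log}$ the principal logarithm. For $|z|<1$ put $\Phi_n(z)^{-1/n}=\exp\bigl(-\tfrac1n\log\hat\Phi_n(z)\bigr)$ if $n\ge2$, and $\Phi_1(z)^{-1}=1/(z-1)$. Infinite products and sums over $n$ are limits of the partial products and sums over $1\le n\le N$ as $N\to\infty$. Then: (1) the product $P(z)=-\prod_{n=1}^{\infty}\Phi_n(z)^{-1/n}$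 converges locally uniformly on $|z|<1$, and $P(z)\equiv 1$ there; (2) the series $\sum_{n=1}^{\infty}\frac{\log\hat\Phi_n(z)}{n}$ converges locally uniformly on $|z|<1$, and its sum is identically $0$ there; (3) the following statements are equivalent (hence all true): (a) for every $|z|<1$ the product $P(z)$ converges to $1$; (b) for every $|z|<1$ the series $\sum_{n=1}^{\infty}\frac{\log\hat\Phi_n(z)}{n}$ converges to $0$; (c) for every integer $m\ge1$ the series $\sum_{n=1}^{\infty}\frac{c_n(m)}{n}$ converges to $0$. -/

import Mathlib

namespace CyclotomicProduct

noncomputable section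

/-- The integers `1 ≤ k ≤ n` coprime to `n`. -/
def residues (n : ℕ) : Finset ℕ := (Finset.Icc 1 n).filter fun k => Nat.gcd k n = 1

/-- `exp (2 π i k / n)`. -/
def root (n k : ℕ) : ℂ := Complex.exp (2 * Real.pi * Complex.I * k / n)

/-- The Ramanujan sum `c_n(m) = ∑_{1 ≤ k ≤ n, gcd(k,n) = 1} exp (2 π i k m / n)`. -/
def ramanujanSum (n m : ℕ) : ℂ :=
  ∑ k ∈ residues n, Complex.exp (2 * Real.pi * Complex.I * k * m / n)

/-- The normalised cyclotomic polynomial function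
`∏_{1 ≤ k ≤ n, gcd(k,n) = 1} (1 - z exp (2 π i k / n))`. -/
def phiHat (n : ℕ) (z : ℂ) : ℂ := ∏ k ∈ residues n, (1 - z * root n k)

/-- The holomorphic logarithm of `phiHat n` on the open unit disk that vanishes at `0`.
Each `1 - z exp (2 π i k / n)` has positive real part for `|z| < 1`, so the principal
logarithms below are holomorphic there. (The principal logarithm of the product itself
need not be continuous on the disk.) -/
def logPhiHat (n : ℕ) (z : ℂ) : ℂ := ∑ k ∈ residues n, Complex.log (1 - z * root n k)

/-- The factor `Φ_n(z) ^ (-1/n)` for `|z| < 1`. For `n = 1` the exponent is `-1`, so no branch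
is involved and this is the reciprocal of `Φ_1(z) = z - 1`. For `n ≥ 2` this is the holomorphic
branch on the disk that equals `1` at `z = 0`. -/
def cyclotomicFactor (n : ℕ) (z : ℂ) : ℂ :=
  if n = 1 then ((Polynomial.cyclotomic 1 ℂ).eval z)⁻¹
  else Complex.exp (-(logPhiHat n z / n))

/-- The partial product `P_N(z) = - ∏_{n=1}^N Φ_n(z) ^ (-1/n)`. -/
def partialProduct (N : ℕ) (z : ℂ) : ℂ := -∏ n ∈ Finset.Icc 1 N, cyclotomicFactor n z

/-- The partial sum `∑_{n=1}^N (log phiHat_n(z)) / n`. -/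
def logPartialSum (N : ℕ) (z : ℂ) : ℂ := ∑ n ∈ Finset.Icc 1 N, logPhiHat n z / n

/-- The partial sum `∑_{n=1}^N c_n(m) / n`. -/
def ramanujanPartialSum (N m : ℕ) : ℂ := ∑ n ∈ Finset.Icc 1 N, ramanujanSum n m / n

/-! Facts that confirm the choice of branches. -/

theorem norm_root (n k : ℕ) : ‖root n k‖ = 1 := by
  have : (2 * Real.pi * Complex.I * k / n : ℂ) = ((2 * Real.pi * k / n : ℝ) : ℂ) * Complex.I := by
    push_cast; ring
  rw [root, this, Complex.norm_exp_ofReal_mul_I]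

theorem one_sub_mem_slitPlane (n k : ℕ) {z : ℂ} (hz : ‖z‖ < 1) :
    1 - z * root n k ∈ Complex.slitPlane := by
  rw [sub_eq_add_neg]
  apply Complex.mem_slitPlane_of_norm_lt_one
  rw [norm_neg, norm_mul, norm_root, mul_one]
  exact hz

theorem phiHat_one (z : ℂ) : phiHat 1 z = 1 - z := by
  have h : residues 1 = {1} := by decide
  have h1 : root 1 1 = 1 := by simp [root, Complex.exp_two_pi_mul_I]
  simp [phiHat, h, h1]

theorem prod_residues {n : ℕ} (hn : n ≠ 0) (f : ℂ → ℂ) :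
    ∏ k ∈ residues n, f (root n k) = ∏ ζ ∈ primitiveRoots n ℂ, f ζ := by
  have hp : IsPrimitiveRoot (root n 1) n := by
    have := Complex.isPrimitiveRoot_exp n hn
    simpa [root] using this
  have hr : ∀ k, root n k = root n 1 ^ k := fun k => by
    rw [root, root, ← Complex.exp_nat_mul]
    congr 1
    push_cast
    ring
  refine Finset.prod_bij (fun k _ => root n k) ?_ ?_ ?_ (fun _ _ => rfl)
  · intro k hk
    simp only [residues, Finset.mem_filter, Finset.mem_Icc] at hk
    rw [mem_primitiveRoots (Nat.pos_of_ne_zero hn), hr]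
    exact hp.pow_of_coprime k hk.2
  · intro a ha b hb hab
    simp only [residues, Finset.mem_filter, Finset.mem_Icc] at ha hb
    rw [hr a, hr b, (Nat.sub_add_cancel ha.1.1).symm, (Nat.sub_add_cancel hb.1.1).symm,
      pow_succ, pow_succ] at hab
    have := hp.pow_inj (by omega) (by omega)
      (mul_right_cancel₀ (hp.ne_zero hn) hab)
    omega
  · intro ζ hζ
    rw [mem_primitiveRoots (Nat.pos_of_ne_zero hn)] at hζ
    have : NeZero n := ⟨hn⟩
    obtain ⟨i, hi, hc, rfl⟩ := (hp.isPrimitiveRoot_iff).1 hζ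
    rcases Nat.eq_zero_or_pos i with h0 | h0
    · subst h0
      have h1 : n = 1 := by simpa using hc
      subst h1
      refine ⟨1, by decide, ?_⟩
      simp [root, Complex.exp_two_pi_mul_I]
    · refine ⟨i, ?_, hr i⟩
      simp only [residues, Finset.mem_filter, Finset.mem_Icc]
      exact ⟨⟨h0, hi.le⟩, hc⟩

theorem phiHat_eq_cyclotomic {n : ℕ} (hn : 2 ≤ n) (z : ℂ) :
    phiHat n z = (Polynomial.cyclotomic n ℂ).eval z := by
  have hn0 : n ≠ 0 := by omega
  have hp := Complex.isPrimitiveRoot_exp n hn0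
  have h0 : ∏ ζ ∈ primitiveRoots n ℂ, (-ζ) = 1 := by
    have h := Polynomial.cyclotomic_coeff_zero ℂ (show 1 < n by omega)
    rw [Polynomial.coeff_zero_eq_eval_zero,
      Polynomial.cyclotomic_eq_prod_X_sub_primitiveRoots hp, Polynomial.eval_prod] at h
    simpa using h
  rw [Polynomial.cyclotomic_eq_prod_X_sub_primitiveRoots hp, Polynomial.eval_prod, phiHat,
    prod_residues hn0 (fun ζ => 1 - z * ζ)]
  have hinv : ∏ ζ ∈ primitiveRoots n ℂ, (1 - z * ζ)
      = ∏ ζ ∈ primitiveRoots n ℂ, (1 - z * ζ⁻¹) := by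
    refine Finset.prod_bij (fun ζ _ => ζ⁻¹) ?_ ?_ ?_ ?_
    · intro ζ hζ
      rw [mem_primitiveRoots (Nat.pos_of_ne_zero hn0)] at hζ ⊢
      exact hζ.inv
    · intro a _ b _ h
      exact inv_injective h
    · intro ζ hζ
      rw [mem_primitiveRoots (Nat.pos_of_ne_zero hn0)] at hζ
      exact ⟨ζ⁻¹, (mem_primitiveRoots (Nat.pos_of_ne_zero hn0)).2 hζ.inv, inv_inv ζ⟩
    · intro ζ _
      rw [inv_inv]
  refine hinv.trans ((one_mul _).symm.trans ?_)
  refine (congrArg (· * _) h0.symm).trans ?_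
  rw [← Finset.prod_mul_distrib]
  refine Finset.prod_congr rfl fun ζ hζ => ?_
  rw [mem_primitiveRoots (Nat.pos_of_ne_zero hn0)] at hζ
  have := hζ.ne_zero hn0
  simp only [Polynomial.eval_sub, Polynomial.eval_X, Polynomial.eval_C]
  field_simp
  ring

theorem exp_logPhiHat (n : ℕ) {z : ℂ} (hz : ‖z‖ < 1) :
    Complex.exp (logPhiHat n z) = phiHat n z := by
  rw [logPhiHat, Complex.exp_sum, phiHat]
  exact Finset.prod_congr rfl fun k _ =>
    Complex.exp_log (Complex.slitPlane_ne_zero (one_sub_mem_slitPlane n k hz))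

theorem logPhiHat_zero (n : ℕ) : logPhiHat n 0 = 0 := by
  simp [logPhiHat]

theorem differentiableOn_logPhiHat (n : ℕ) :
    DifferentiableOn ℂ (logPhiHat n) (Metric.ball 0 1) := by
  unfold logPhiHat
  refine DifferentiableOn.fun_sum fun k _ => ?_
  refine DifferentiableOn.clog (by fun_prop) fun z hz => ?_
  exact one_sub_mem_slitPlane n k (by simpa using hz)

theorem cyclotomicFactor_pow {n : ℕ} (hn : 1 ≤ n) {z : ℂ} (hz : ‖z‖ < 1) :
    cyclotomicFactor n z ^ n = ((Polynomial.cyclotomic n ℂ).eval z)⁻¹ := by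
  by_cases h : n = 1
  · subst h
    simp [cyclotomicFactor]
  · have hn0 : (n : ℂ) ≠ 0 := by exact_mod_cast (show n ≠ 0 by omega)
    rw [cyclotomicFactor, if_neg h, ← Complex.exp_nat_mul,
      ← phiHat_eq_cyclotomic (show 2 ≤ n by omega), ← exp_logPhiHat n hz, ← Complex.exp_neg]
    congr 1
    field_simp

theorem cyclotomicFactor_zero {n : ℕ} (hn : 2 ≤ n) : cyclotomicFactor n 0 = 1 := by
  rw [cyclotomicFactor, if_neg (by omega), logPhiHat_zero]
  simp

end

end CyclotomicProduct

/-! Expanding the logarithms at `0` gives `logPartialSum N z = -∑ₘ R_N(m) zᵐ/m` with `R_N(m) = ∑_{n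
≤ N} cₙ(m)/n`. Since `cₙ(m)/n` is the Dirichlet convolution of the indicator of the divisors of `m`
with `μ(d)/d`, `R_N(m) = ∑_{e ∣ m} M(N/e)`, where `M(x) = ∑_{k ≤ x} μ(k)/k`. Two facts about `M`
suffice: `|M| ≤ 1`, so `|R_N(m)| ≤ m` and `∑ rᵐ` dominates the series on `|z| ≤ r < 1`; and `M(x) →
0`, so each coefficient tends to `0`. Dominated convergence gives the logarithmic series, and
exponentiating gives the product.

The deep input is `M(x) → 0`, of the strength of the prime number theorem. It follows from a
Tauberian theorem (`tendsto_zero_of_laplace`) applied to `t ↦ M(eᵗ)`, whose Laplace transform `1/(z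
ζ(z+1))` extends continuously to `Re z ≥ 0` because `ζ` has no zero on `Re s = 1` and a simple pole
at `1`. -/

namespace CyclotomicProduct

open MeasureTheory Filter Topology FourierTransform

/-! ### A Tauberian theorem for Laplace transforms. -/

section Tauberian

variable {f : ℝ → ℂ} {C : ℝ} {G : ℂ → ℂ}

theorem integrable_mul_exp_neg (hf : AEStronglyMeasurable f) (hC : ∀ t, ‖f t‖ ≤ C)
    (h0 : ∀ t < 0, f t = 0) {ε : ℝ} (hε : 0 < ε) :
    Integrable fun t : ℝ => f t * Complex.exp (-(ε * t : ℂ)) := by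
  have hint : Integrable ((Set.Ioi (0 : ℝ)).indicator fun t => C * Real.exp (-ε * t)) :=
    (integrable_indicator_iff measurableSet_Ioi).2 ((exp_neg_integrableOn_Ioi 0 hε).const_mul C)
  refine hint.mono (hf.mul (by fun_prop)) ?_
  filter_upwards [Measure.ae_ne volume (0 : ℝ)] with t ht
  rcases lt_or_gt_of_ne ht with h | h
  · simp [h0 t h]
  · have hexp : ‖Complex.exp (-(ε * t : ℂ))‖ = Real.exp (-ε * t) := by
      rw [Complex.norm_exp]; simp
    rw [Set.indicator_of_mem (Set.mem_Ioi.2 h), norm_mul, hexp, norm_mul, Real.norm_of_nonneg (Real.exp_nonneg _)]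
    gcongr
    exact (hC t).trans (le_abs_self C)

/-- Parseval by Fubini: the damping `e^{-εt}` makes the double integral absolutely convergent, and
the inner `t`-integral is a Laplace transform on the line `Re z = ε`. -/
theorem integral_damped_mul_fourier (hf : AEStronglyMeasurable f) (hC : ∀ t, ‖f t‖ ≤ C)
    (h0 : ∀ t < 0, f t = 0)
    (hG : ∀ z : ℂ, 0 < z.re → ∫ t : ℝ, f t * Complex.exp (-(z * t)) = G z)
    (ψ : SchwartzMap ℝ ℂ) {ε : ℝ} (hε : 0 < ε) (T : ℝ) :
    ∫ t : ℝ, f t * Complex.exp (-(ε * t : ℂ)) * 𝓕 (ψ : ℝ → ℂ) (t - T) =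
      ∫ y : ℝ, Complex.exp (2 * Real.pi * y * T * Complex.I) *
        (ψ y * G (ε + 2 * Real.pi * y * Complex.I)) := by
  have hint := integrable_mul_exp_neg hf hC h0 hε
  have hprod : Integrable (Function.uncurry fun (t y : ℝ) =>
      f t * Complex.exp (-(ε * t : ℂ)) *
        (Complex.exp (((-2 * Real.pi * y * (t - T) : ℝ) : ℂ) * Complex.I) * ψ y))
      (volume.prod volume) := by
    refine (hint.mul_prod ψ.integrable).mono ?_ (Eventually.of_forall fun p => ?_)
    · refine AEStronglyMeasurable.mul hint.aestronglyMeasurable.comp_fst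
        (AEStronglyMeasurable.mul ?_ ?_)
      · exact Continuous.aestronglyMeasurable (by fun_prop)
      · exact (ψ.continuous.comp continuous_snd).aestronglyMeasurable
    · simp only [Function.uncurry, norm_mul, Complex.norm_exp_ofReal_mul_I, one_mul, le_refl]
  have hswap := integral_integral_swap hprod
  calc _ = ∫ t : ℝ, ∫ y : ℝ, f t * Complex.exp (-(ε * t : ℂ)) *
        (Complex.exp (((-2 * Real.pi * y * (t - T) : ℝ) : ℂ) * Complex.I) * ψ y) := by
        refine integral_congr_ae (Eventually.of_forall fun t => ?_)
        simp only [Real.fourier_real_eq_integral_exp_smul, smul_eq_mul]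
        rw [integral_const_mul]
    _ = _ := hswap
    _ = _ := by
        refine integral_congr_ae (Eventually.of_forall fun y => ?_)
        simp only
        rw [← hG _ (by simpa using hε), ← integral_const_mul, ← integral_const_mul]
        refine integral_congr_ae (Eventually.of_forall fun t => ?_)
        simp only
        have hexp : Complex.exp (-(ε * t : ℂ)) *
            Complex.exp (((-2 * Real.pi * y * (t - T) : ℝ) : ℂ) * Complex.I) =
            Complex.exp (2 * Real.pi * y * T * Complex.I) *
              Complex.exp (-((ε + 2 * Real.pi * y * Complex.I) * t)) := by
          rw [← Complex.exp_add, ← Complex.exp_add]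
          congr 1
          push_cast
          ring
        linear_combination f t * ψ y * hexp

/-- The limit `ε → 0⁺` of the damped identity, by dominated convergence on both sides. -/
theorem integral_mul_fourier (hf : AEStronglyMeasurable f) (hC : ∀ t, ‖f t‖ ≤ C)
    (h0 : ∀ t < 0, f t = 0) (hGc : ContinuousOn G {z | 0 ≤ z.re})
    (hG : ∀ z : ℂ, 0 < z.re → ∫ t : ℝ, f t * Complex.exp (-(z * t)) = G z)
    (ψ : SchwartzMap ℝ ℂ) (hψ : HasCompactSupport ψ) (T : ℝ) :
    ∫ t : ℝ, f t * 𝓕 (ψ : ℝ → ℂ) (t - T) =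
      ∫ y : ℝ, Complex.exp (2 * Real.pi * y * T * Complex.I) *
        (ψ y * G (2 * Real.pi * y * Complex.I)) := by
  have hK : Integrable (𝓕 (ψ : ℝ → ℂ)) := by
    rw [← SchwartzMap.fourier_coe]; exact (𝓕 ψ).integrable
  have hKT : Integrable fun t => 𝓕 (ψ : ℝ → ℂ) (t - T) := hK.comp_sub_right T
  have hpos : ∀ᶠ ε : ℝ in 𝓝[>] 0, 0 < ε := self_mem_nhdsWithin
  have hle : ∀ᶠ ε : ℝ in 𝓝[>] 0, ε ≤ 1 :=
    nhdsWithin_le_nhds (eventually_le_nhds one_pos)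
  have hL : Tendsto (fun ε : ℝ => ∫ t : ℝ,
      f t * Complex.exp (-(ε * t : ℂ)) * 𝓕 (ψ : ℝ → ℂ) (t - T)) (𝓝[>] 0)
      (𝓝 (∫ t : ℝ, f t * 𝓕 (ψ : ℝ → ℂ) (t - T))) := by
    refine tendsto_integral_filter_of_dominated_convergence
      (fun t => C * ‖𝓕 (ψ : ℝ → ℂ) (t - T)‖) ?_ ?_ (hKT.norm.const_mul C) ?_
    · exact Eventually.of_forall fun ε => (hf.mul (by fun_prop)).mul hKT.aestronglyMeasurable
    · filter_upwards [hpos] with ε hε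
      refine Eventually.of_forall fun t => ?_
      rw [norm_mul, norm_mul]
      have hC0 : 0 ≤ C := (norm_nonneg _).trans (hC 0)
      gcongr
      rcases lt_or_ge t 0 with h | h
      · simp [h0 t h, hC0]
      · refine (mul_le_of_le_one_right (norm_nonneg _) ?_).trans (hC t)
        rw [Complex.norm_exp]
        simpa using mul_nonneg hε.le h
    · refine Eventually.of_forall fun t => Tendsto.mono_left ?_ nhdsWithin_le_nhds
      refine Continuous.tendsto' (by fun_prop) _ _ (by simp)
  -- Compact support of `ψ` confines `G` to a compact piece of the closed half-plane, which yields a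
  -- bound uniform in `ε ≤ 1`.
  obtain ⟨M, hM⟩ : ∃ M, ∀ p ∈ Set.Icc (0 : ℝ) 1 ×ˢ tsupport ψ,
      ‖G (p.1 + 2 * Real.pi * p.2 * Complex.I)‖ ≤ M := by
    refine (isCompact_Icc.prod hψ).exists_bound_of_continuousOn
      (f := fun p : ℝ × ℝ => G (p.1 + 2 * Real.pi * p.2 * Complex.I)) ?_
    refine hGc.comp (by fun_prop) fun p hp => ?_
    simpa using hp.1.1
  have hcont : ∀ ε : ℝ, 0 ≤ ε → Continuous fun y : ℝ => G (ε + 2 * Real.pi * y * Complex.I) :=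
    fun ε hε => hGc.comp_continuous (by fun_prop) fun y => by simpa using hε
  have hR : Tendsto (fun ε : ℝ => ∫ y : ℝ, Complex.exp (2 * Real.pi * y * T * Complex.I) *
        (ψ y * G (ε + 2 * Real.pi * y * Complex.I))) (𝓝[>] 0)
      (𝓝 (∫ y : ℝ, Complex.exp (2 * Real.pi * y * T * Complex.I) *
        (ψ y * G (2 * Real.pi * y * Complex.I)))) := by
    refine tendsto_integral_filter_of_dominated_convergence
      (fun y => ‖ψ y‖ * M) ?_ ?_ (ψ.integrable.norm.mul_const M) ?_
    · filter_upwards [hpos] with ε hε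
      have := hcont ε hε.le
      exact (Continuous.mul (by fun_prop) (ψ.continuous.mul this)).aestronglyMeasurable
    · filter_upwards [hpos, hle] with ε hε hε1
      refine Eventually.of_forall fun y => ?_
      have h1 : ‖Complex.exp (2 * Real.pi * y * T * Complex.I)‖ = 1 := by
        have := Complex.norm_exp_ofReal_mul_I (2 * Real.pi * y * T)
        simpa using this
      rw [norm_mul, h1, one_mul, norm_mul]
      by_cases hy : y ∈ tsupport ψ
      · gcongr
        exact hM (ε, y) ⟨⟨hε.le, hε1⟩, hy⟩
      · simp [image_eq_zero_of_notMem_tsupport hy]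
    · refine Eventually.of_forall fun y => (Tendsto.const_mul _ ?_).const_mul _
      have h2 : ContinuousWithinAt (fun ε : ℝ => G (ε + 2 * Real.pi * y * Complex.I))
          (Set.Ici 0) 0 := by
        refine ContinuousOn.continuousWithinAt (hGc.comp (by fun_prop) fun ε hε => ?_)
          Set.self_mem_Ici
        simpa using hε
      have h3 := h2.tendsto.mono_left (nhdsWithin_mono _ Set.Ioi_subset_Ici_self)
      simpa using h3
  refine tendsto_nhds_unique hL (hR.congr' ?_)
  filter_upwards [hpos] with ε hε
  exact (integral_damped_mul_fourier hf hC h0 hG ψ hε T).symm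

/-- Riemann–Lebesgue on the boundary line; the phase `e^{+2πiyT}` means that the transform is
evaluated at `-T`. -/
theorem tendsto_integral_mul_fourier (hf : AEStronglyMeasurable f) (hC : ∀ t, ‖f t‖ ≤ C)
    (h0 : ∀ t < 0, f t = 0) (hGc : ContinuousOn G {z | 0 ≤ z.re})
    (hG : ∀ z : ℂ, 0 < z.re → ∫ t : ℝ, f t * Complex.exp (-(z * t)) = G z)
    (ψ : SchwartzMap ℝ ℂ) (hψ : HasCompactSupport ψ) :
    Tendsto (fun T : ℝ => ∫ t : ℝ, f t * 𝓕 (ψ : ℝ → ℂ) (t - T)) atTop (𝓝 0) := by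
  have h := (Real.tendsto_integral_exp_smul_cocompact
    fun y : ℝ => ψ y * G (2 * Real.pi * y * Complex.I)).comp
    (tendsto_neg_atTop_atBot.mono_right atBot_le_cocompact)
  refine h.congr fun T => ?_
  rw [integral_mul_fourier hf hC h0 hGc hG ψ hψ T]
  refine integral_congr_ae (Eventually.of_forall fun y => ?_)
  simp only [Circle.smul_def, Real.fourierChar_apply, smul_eq_mul]
  congr 2
  push_cast
  ring

/-- For a smooth bump `ψ`, Fourier inversion at `0` turns `ψ 0 = 1` into total mass `1` for its
transform. -/
theorem exists_fourier_kernel : ∃ ψ : SchwartzMap ℝ ℂ, HasCompactSupport ψ ∧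
    Integrable (𝓕 (ψ : ℝ → ℂ)) ∧ ∫ x, 𝓕 (ψ : ℝ → ℂ) x = 1 := by
  let b : ContDiffBump (0 : ℝ) := default
  have hb : HasCompactSupport fun x : ℝ => (b x : ℂ) :=
    b.hasCompactSupport.comp_left (g := fun x : ℝ => (x : ℂ)) (by simp)
  let ψ : SchwartzMap ℝ ℂ := hb.toSchwartzMap (Complex.ofRealCLM.contDiff.comp b.contDiff)
  have hK : Integrable (𝓕 (ψ : ℝ → ℂ)) := by
    rw [← SchwartzMap.fourier_coe]; exact (𝓕 ψ).integrable
  refine ⟨ψ, hb, hK, ?_⟩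
  have h := ψ.integrable.fourierInv_fourier_eq hK (v := 0) ψ.continuous.continuousAt
  rw [Real.fourierInv_eq'] at h
  have h1 : ψ 0 = 1 := by
    change ((b 0 : ℝ) : ℂ) = 1
    rw [b.one_of_mem_closedBall (by simpa using b.rIn_pos.le)]
    simp
  simpa [h1] using h

/-- A bounded, slowly oscillating function whose Laplace transform extends continuously to the
closed right half-plane tends to zero. -/
theorem tendsto_zero_of_laplace (hf : AEStronglyMeasurable f) (hC : ∀ t, ‖f t‖ ≤ C)
    (h0 : ∀ t < 0, f t = 0) (hGc : ContinuousOn G {z | 0 ≤ z.re})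
    (hG : ∀ z : ℂ, 0 < z.re → ∫ t : ℝ, f t * Complex.exp (-(z * t)) = G z)
    (hosc : ∀ a u : ℝ, ‖f a - f (a + u)‖ ≤ Real.exp |u| - 1 + Real.exp (|u| - a)) :
    Tendsto f atTop (𝓝 0) := by
  obtain ⟨ψ, hψ, hK, hK1⟩ := exists_fourier_kernel
  set K : ℝ → ℂ := 𝓕 (ψ : ℝ → ℂ) with hKdef
  have hC0 : 0 ≤ C := (norm_nonneg _).trans (hC 0)
  -- the kernel at scale `δ`
  have hconv : ∀ δ : ℝ, 0 < δ →
      Tendsto (fun T : ℝ => ∫ v : ℝ, f (T + δ * v) * K v) atTop (𝓝 0) := by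
    intro δ hδ
    have hmeas : AEStronglyMeasurable fun v => f (δ * v) :=
      hf.comp_quasiMeasurePreserving (Measure.quasiMeasurePreserving_smul volume hδ.ne')
    -- Instead of shrinking the kernel, `f` is dilated: `v ↦ f (δ v)` has Laplace transform `δ⁻¹
    -- G(z/δ)`.
    have h := tendsto_integral_mul_fourier (f := fun v => f (δ * v))
      (G := fun z => (δ⁻¹ : ℂ) * G (δ⁻¹ * z)) hmeas (fun v => hC _)
      (fun v hv => h0 _ (mul_neg_of_pos_of_neg hδ hv))
      (continuousOn_const.mul (hGc.comp (by fun_prop) fun z (hz : 0 ≤ z.re) => by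
        have : (0 : ℝ) ≤ δ⁻¹ * z.re := by positivity
        simpa [← Complex.ofReal_inv] using this))
      (fun z hz => by
        have hz' : 0 < ((δ⁻¹ : ℂ) * z).re := by
          have : (0 : ℝ) < δ⁻¹ * z.re := by positivity
          simpa [← Complex.ofReal_inv] using this
        have := Measure.integral_comp_mul_left
          (fun t : ℝ => f t * Complex.exp (-(((δ : ℂ)⁻¹ * z) * t))) δ
        rw [hG _ hz', abs_of_pos (by positivity : 0 < δ⁻¹), Complex.real_smul] at this
        rw [Complex.ofReal_inv] at this ⊢
        rw [← this]
        refine integral_congr_ae (Eventually.of_forall fun v => ?_)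
        simp only
        congr 3
        have : (δ : ℂ) ≠ 0 := by exact_mod_cast hδ.ne'
        push_cast
        field_simp) ψ hψ
    refine (h.comp (tendsto_id.atTop_mul_const (inv_pos.2 hδ))).congr fun T => ?_
    simp only [Function.comp, id]
    rw [← integral_add_right_eq_self _ (T * δ⁻¹)]
    refine integral_congr_ae (Eventually.of_forall fun v => ?_)
    simp only [add_sub_cancel_right]
    congr 2
    field_simp
    ring
  -- Bound for the error of replacing `f T` by its `K`-average at scale `δ`. Truncating at `2C`
  -- keeps the integrand dominated by a multiple of `‖K‖`, whereas `e^{δ|v|} ‖K v‖` need not be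
  -- integrable. The limits are taken in the order `T → ∞`, then `δ → 0⁺`.
  let D : ℝ → ℝ → ℝ := fun δ T => ∫ v : ℝ,
    min (2 * C) (Real.exp (δ * |v|) - 1 + Real.exp (δ * |v| - T)) * ‖K v‖
  have hbound : ∀ δ : ℝ, 0 < δ → ∀ T : ℝ,
      ‖f T‖ ≤ D δ T + ‖∫ v : ℝ, f (T + δ * v) * K v‖ := by
    intro δ hδ T
    have hm : AEStronglyMeasurable fun v => f (T + δ * v) := by
      have h1 : AEStronglyMeasurable fun v => f (T + v) :=
        hf.comp_measurePreserving (measurePreserving_add_left volume T)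
      exact h1.comp_quasiMeasurePreserving (Measure.quasiMeasurePreserving_smul volume hδ.ne')
    have hi : Integrable fun v => f (T + δ * v) * K v :=
      hK.bdd_mul hm (Eventually.of_forall fun v => hC _)
    have hsub : f T = (∫ v : ℝ, (f T - f (T + δ * v)) * K v) +
        ∫ v : ℝ, f (T + δ * v) * K v := by
      simp_rw [sub_mul]
      rw [integral_sub (hK.const_mul _) hi, integral_const_mul, hK1]
      ring
    conv_lhs => rw [hsub]
    refine (norm_add_le _ _).trans (add_le_add_left ?_ _)
    refine norm_integral_le_of_norm_le ?_ (Eventually.of_forall fun v => ?_)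
    · refine hK.norm.bdd_mul (c := 2 * C)
        (Continuous.aestronglyMeasurable (by fun_prop)) (Eventually.of_forall fun v => ?_)
      rw [Real.norm_of_nonneg]
      · exact min_le_left _ _
      · refine le_min (by positivity) (add_nonneg (sub_nonneg.2 ?_) (Real.exp_nonneg _))
        exact Real.one_le_exp (by positivity)
    · rw [norm_mul]
      gcongr
      refine le_min ?_ ?_
      · refine (norm_sub_le _ _).trans ?_
        linarith [hC T, hC (T + δ * v)]
      · simpa [abs_mul, abs_of_pos hδ] using hosc T (δ * v)
  have hmin : ∀ δ : ℝ, 0 ≤ δ → ∀ (T : ℝ) (v : ℝ),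
      ‖min (2 * C) (Real.exp (δ * |v|) - 1 + Real.exp (δ * |v| - T)) * ‖K v‖‖ ≤
        2 * C * ‖K v‖ := by
    intro δ hδ T v
    rw [norm_mul, norm_norm]
    gcongr
    rw [Real.norm_of_nonneg]
    · exact min_le_left _ _
    · refine le_min (by positivity) (add_nonneg (sub_nonneg.2 ?_) (Real.exp_nonneg _))
      exact Real.one_le_exp (by positivity)
  have hDT : ∀ δ : ℝ, 0 < δ → Tendsto (D δ) atTop
      (𝓝 (∫ v : ℝ, min (2 * C) (Real.exp (δ * |v|) - 1) * ‖K v‖)) := by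
    intro δ hδ
    refine tendsto_integral_filter_of_dominated_convergence (fun v => 2 * C * ‖K v‖)
      (Eventually.of_forall fun T => ?_) (Eventually.of_forall fun T =>
        Eventually.of_forall fun v => hmin δ hδ.le T v) (hK.norm.const_mul _)
      (Eventually.of_forall fun v => ?_)
    · exact (Continuous.aestronglyMeasurable (by fun_prop)).mul hK.norm.aestronglyMeasurable
    · refine Tendsto.mul_const _ (Tendsto.min tendsto_const_nhds ?_)
      have : Tendsto (fun T : ℝ => Real.exp (δ * |v| - T)) atTop (𝓝 0) :=
        Real.tendsto_exp_atBot.comp (tendsto_const_nhds.add_atBot tendsto_neg_atTop_atBot)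
      simpa using this.const_add (Real.exp (δ * |v|) - 1)
  have hδ0 : Tendsto (fun δ : ℝ => ∫ v : ℝ, min (2 * C) (Real.exp (δ * |v|) - 1) * ‖K v‖)
      (𝓝[>] 0) (𝓝 0) := by
    have h : Tendsto (fun δ : ℝ => ∫ v : ℝ, min (2 * C) (Real.exp (δ * |v|) - 1) * ‖K v‖)
        (𝓝[>] 0) (𝓝 (∫ v : ℝ, 0)) := by
      refine tendsto_integral_filter_of_dominated_convergence (fun v => 2 * C * ‖K v‖)
        (Eventually.of_forall fun δ => ?_) ?_ (hK.norm.const_mul _)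
        (Eventually.of_forall fun v => ?_)
      · exact (Continuous.aestronglyMeasurable (by fun_prop)).mul hK.norm.aestronglyMeasurable
      · filter_upwards [self_mem_nhdsWithin] with δ hδ
        refine Eventually.of_forall fun v => ?_
        rw [norm_mul, norm_norm]
        gcongr
        rw [Real.norm_of_nonneg]
        · exact min_le_left _ _
        · refine le_min (by positivity) (sub_nonneg.2 ?_)
          exact Real.one_le_exp (mul_nonneg (le_of_lt hδ) (abs_nonneg v))
      · refine Tendsto.mono_left ?_ nhdsWithin_le_nhds
        refine Continuous.tendsto' (by fun_prop) _ _ ?_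
        simp [hC0]
    simpa using h
  rw [tendsto_zero_iff_norm_tendsto_zero, Metric.tendsto_atTop']
  intro ε hε
  obtain ⟨δ, hδε, hδ⟩ := ((hδ0.eventually_lt_const (half_pos hε)).and
    (self_mem_nhdsWithin : ∀ᶠ δ : ℝ in 𝓝[>] 0, 0 < δ)).exists
  have h1 := (hDT δ hδ).eventually_lt_const hδε
  have h2 := (hconv δ hδ).norm.eventually_lt_const (u := ε / 2) (by simpa using hε)
  obtain ⟨N, hN⟩ := (h1.and h2).exists_forall_of_atTop
  refine ⟨N, fun T hT => ?_⟩
  obtain ⟨h3, h4⟩ := hN T hT.le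
  rw [dist_zero_right, norm_norm]
  linarith [hbound δ hδ T]

end Tauberian

end CyclotomicProduct

/-! ### Bounds and slow oscillation for `∑ μ(k)/k`. -/

namespace CyclotomicProduct

open MeasureTheory Filter Topology

/-- The summatory function `∑_{k ≤ x} μ(k) / k`. -/
noncomputable def moebiusSum (x : ℝ) : ℂ :=
  ∑ k ∈ Finset.Icc 1 ⌊x⌋₊, (ArithmeticFunction.moebius k : ℂ) / k

theorem moebiusSum_of_lt_one {x : ℝ} (hx : x < 1) : moebiusSum x = 0 := by
  simp [moebiusSum, Nat.floor_eq_zero.2 hx]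

theorem norm_moebius_le_one (k : ℕ) : ‖(ArithmeticFunction.moebius k : ℂ)‖ ≤ 1 := by
  rw [Complex.norm_intCast]
  exact_mod_cast ArithmeticFunction.abs_moebius_le_one

/-- The sum of `μ * 1 = δ₁` up to `N`, with the multiples of each `k` counted. -/
theorem sum_moebius_mul_div {N : ℕ} (hN : 1 ≤ N) :
    ∑ k ∈ Finset.Icc 1 N, (ArithmeticFunction.moebius k : ℂ) * ((N / k : ℕ) : ℂ) = 1 := by
  have h := ArithmeticFunction.sum_Ioc_mul_zeta_eq_sum ArithmeticFunction.moebius N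
  have h1 : (ArithmeticFunction.moebius *
      (ArithmeticFunction.zeta : ArithmeticFunction ℤ)) = 1 :=
    ArithmeticFunction.moebius_mul_coe_zeta
  have hI : Finset.Ioc 0 N = Finset.Icc 1 N := by ext; simp [Nat.succ_le_iff]
  rw [h1, hI] at h
  have h2 : ∑ n ∈ Finset.Icc 1 N, (1 : ArithmeticFunction ℤ) n = 1 := by
    rw [Finset.sum_eq_single_of_mem 1 (by simp [hN])]
    · simp
    · intro b _ hb
      exact ArithmeticFunction.one_apply_ne hb
  rw [h2] at h
  have h3 := congrArg (fun a : ℤ => (a : ℂ)) h.symm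
  simpa only [Int.cast_sum, Int.cast_mul, Int.cast_natCast, Int.cast_one] using h3

/-- Multiplying by `N` and splitting `N/k` into integer and fractional parts leaves `1 + ∑ μ(k)
{N/k}`. -/
theorem norm_sum_moebius_div_le (N : ℕ) :
    ‖∑ k ∈ Finset.Icc 1 N, (ArithmeticFunction.moebius k : ℂ) / k‖ ≤ 1 := by
  rcases Nat.eq_zero_or_pos N with rfl | hN
  · simp
  have hN0 : (0 : ℝ) < N := by exact_mod_cast hN
  have hsplit : (N : ℂ) * ∑ k ∈ Finset.Icc 1 N, (ArithmeticFunction.moebius k : ℂ) / k =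
      1 + ∑ k ∈ Finset.Icc 1 N, (ArithmeticFunction.moebius k : ℂ) * ((N % k : ℕ) / k) := by
    rw [← sum_moebius_mul_div hN, Finset.mul_sum, ← Finset.sum_add_distrib]
    refine Finset.sum_congr rfl fun k hk => ?_
    have hk0 : (k : ℂ) ≠ 0 := by
      have := (Finset.mem_Icc.1 hk).1
      exact_mod_cast (by omega : k ≠ 0)
    have h : (N : ℂ) = k * ((N / k : ℕ) : ℂ) + ((N % k : ℕ) : ℂ) := by
      exact_mod_cast (Nat.div_add_mod N k).symm
    field_simp
    rw [mul_comm, h]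
  have hrest : ‖∑ k ∈ Finset.Icc 1 N,
      (ArithmeticFunction.moebius k : ℂ) * ((N % k : ℕ) / k)‖ ≤ N - 1 := by
    -- The term `k = 1` vanishes, so at most `N - 1` remains; this saving absorbs the `1` above.
    rw [← Finset.sum_sdiff (Finset.singleton_subset_iff.2 (Finset.mem_Icc.2 ⟨le_rfl, hN⟩)),
      Finset.sum_singleton]
    simp only [Nat.mod_one, Nat.cast_zero, zero_div, mul_zero, add_zero]
    refine (norm_sum_le_of_le _ (f := _) (n := fun _ => (1 : ℝ)) fun k hk => ?_).trans ?_
    · rw [norm_mul, norm_div, Complex.norm_natCast, Complex.norm_natCast]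
      refine mul_le_one₀ (norm_moebius_le_one k) (by positivity) (div_le_one_of_le₀ ?_ (by simp))
      simp only [Finset.mem_sdiff, Finset.mem_Icc, Finset.mem_singleton] at hk
      exact_mod_cast (Nat.mod_lt N (by omega)).le
    · rw [Finset.sum_const, Finset.card_sdiff_of_subset (by simp; omega)]
      simp [Nat.cast_sub hN]
  have hmul : N * ‖∑ k ∈ Finset.Icc 1 N, (ArithmeticFunction.moebius k : ℂ) / k‖ ≤ N * 1 := by
    rw [← Complex.norm_natCast, ← norm_mul, hsplit, Complex.norm_natCast]
    refine (norm_add_le _ _).trans ?_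
    rw [norm_one]
    linarith
  exact le_of_mul_le_mul_left hmul hN0

theorem norm_moebiusSum_le (x : ℝ) : ‖moebiusSum x‖ ≤ 1 :=
  norm_sum_moebius_div_le _

theorem measurable_moebiusSum : Measurable moebiusSum :=
  (measurable_from_nat (f := fun N : ℕ =>
    ∑ k ∈ Finset.Icc 1 N, (ArithmeticFunction.moebius k : ℂ) / k)).comp Nat.measurable_floor

/-- At most `y - x + 1` integers lie in `(x, y]`, each contributing at most `1/x`. -/
theorem norm_moebiusSum_sub_le {x y : ℝ} (hx : 0 < x) (hxy : x ≤ y) :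
    ‖moebiusSum y - moebiusSum x‖ ≤ (y - x + 1) / x := by
  have hfl : ⌊x⌋₊ ≤ ⌊y⌋₊ := Nat.floor_mono hxy
  have hI : ∀ N : ℕ, Finset.Icc 1 N = Finset.Ioc 0 N := fun N => by
    ext; simp [Nat.succ_le_iff]
  have hd : moebiusSum y - moebiusSum x =
      ∑ k ∈ Finset.Ioc ⌊x⌋₊ ⌊y⌋₊, (ArithmeticFunction.moebius k : ℂ) / k := by
    rw [moebiusSum, moebiusSum, hI, hI, sub_eq_iff_eq_add',
      Finset.sum_Ioc_consecutive _ (Nat.zero_le _) hfl]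
  rw [hd]
  refine (norm_sum_le_of_le _ (n := fun _ => 1 / x) fun k hk => ?_).trans ?_
  · have hk' : x < k := Nat.lt_of_floor_lt (Finset.mem_Ioc.1 hk).1
    rw [norm_div, Complex.norm_natCast]
    exact div_le_div₀ zero_le_one (norm_moebius_le_one k) hx hk'.le
  · rw [Finset.sum_const, Nat.card_Ioc, nsmul_eq_mul, mul_one_div, Nat.cast_sub hfl]
    have h1 := Nat.floor_le (hx.le.trans hxy)
    have h2 := Nat.lt_floor_add_one x
    gcongr
    linarith

theorem norm_moebiusSum_exp_sub_le (a u : ℝ) :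
    ‖moebiusSum (Real.exp a) - moebiusSum (Real.exp (a + u))‖ ≤
      Real.exp |u| - 1 + Real.exp (|u| - a) := by
  rcases le_total 0 u with hu | hu
  · rw [norm_sub_rev, abs_of_nonneg hu]
    refine (norm_moebiusSum_sub_le (Real.exp_pos a) (Real.exp_le_exp.2 (by linarith))).trans ?_
    have h : (Real.exp (a + u) - Real.exp a + 1) / Real.exp a =
        Real.exp u - 1 + Real.exp (-a) := by
      rw [Real.exp_add, Real.exp_neg]
      field_simp
    rw [h]
    gcongr
    linarith
  · rw [abs_of_nonpos hu]
    refine (norm_moebiusSum_sub_le (Real.exp_pos (a + u))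
      (Real.exp_le_exp.2 (by linarith))).trans (le_of_eq ?_)
    rw [sub_eq_add_neg (-u), Real.exp_add, Real.exp_add, Real.exp_neg, Real.exp_neg]
    field_simp

/-! ### The Laplace transform of `M(eᵗ)` and the limit of `M`. -/

/-- The function `s ↦ (s - 1) ζ(s)`, with its removable singularity filled in. -/
noncomputable def zetaMulSubOne : ℂ → ℂ :=
  Function.update (fun s => (s - 1) * riemannZeta s) 1 1

theorem continuous_zetaMulSubOne : Continuous zetaMulSubOne := by
  rw [continuous_iff_continuousAt]
  intro s
  rcases eq_or_ne s 1 with rfl | hs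
  · rw [zetaMulSubOne, continuousAt_update_same]
    exact riemannZeta_residue_one
  · rw [zetaMulSubOne, continuousAt_update_of_ne hs]
    exact ContinuousAt.mul (by fun_prop) (differentiableAt_riemannZeta hs).continuousAt

theorem zetaMulSubOne_ne_zero {s : ℂ} (hs : 1 ≤ s.re) : zetaMulSubOne s ≠ 0 := by
  rcases eq_or_ne s 1 with rfl | h
  · simp [zetaMulSubOne]
  · rw [zetaMulSubOne, Function.update_of_ne h]
    exact mul_ne_zero (sub_ne_zero.2 h) (riemannZeta_ne_zero_of_one_le_re hs)

theorem LSeries_moebius_div (z : ℂ) :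
    LSeries (fun n => (ArithmeticFunction.moebius n : ℂ) / n) z =
      LSeries (fun n => (ArithmeticFunction.moebius n : ℂ)) (z + 1) := by
  refine tsum_congr fun n => ?_
  rcases eq_or_ne n 0 with rfl | hn
  · simp
  · have hn' : (n : ℂ) ≠ 0 := by exact_mod_cast hn
    rw [LSeries.term_of_ne_zero hn, LSeries.term_of_ne_zero hn, Complex.cpow_add _ _ hn',
      Complex.cpow_one, div_div, mul_comm]

theorem LSeriesSummable_moebius_div {z : ℂ} (hz : 0 < z.re) :
    LSeriesSummable (fun n => (ArithmeticFunction.moebius n : ℂ) / n) z := by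
  have h : LSeriesSummable (fun n => (ArithmeticFunction.moebius n : ℂ)) (z + 1) :=
    ArithmeticFunction.LSeriesSummable_moebius_iff.2 (by simpa using hz)
  refine h.congr fun n => ?_
  rcases eq_or_ne n 0 with rfl | hn
  · simp
  · have hn' : (n : ℂ) ≠ 0 := by exact_mod_cast hn
    rw [LSeries.term_of_ne_zero hn, LSeries.term_of_ne_zero hn, Complex.cpow_add _ _ hn',
      Complex.cpow_one, div_div, mul_comm]

theorem integral_moebiusSum_exp_eq (z : ℂ) :
    ∫ t : ℝ, moebiusSum (Real.exp t) * Complex.exp (-(z * t)) =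
      ∫ x in Set.Ioi (1 : ℝ), moebiusSum x * (x : ℂ) ^ (-(z + 1)) := by
  have himg : Real.exp '' Set.Ioi 0 = Set.Ioi 1 := by
    ext x
    simp only [Set.mem_image, Set.mem_Ioi]
    constructor
    · rintro ⟨t, ht, rfl⟩
      exact Real.one_lt_exp_iff.2 ht
    · intro hx
      exact ⟨Real.log x, Real.log_pos hx, Real.exp_log (by linarith)⟩
  -- Substitution `x = eᵗ`. The left integrand vanishes only for `t < 0`, hence the passage through
  -- `Ici 0`.
  rw [← himg, integral_image_eq_integral_abs_deriv_smul measurableSet_Ioi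
    (fun x _ => (Real.hasDerivAt_exp x).hasDerivWithinAt) Real.exp_injective.injOn,
    ← integral_Ici_eq_integral_Ioi, ← setIntegral_eq_integral_of_forall_compl_eq_zero
      (s := Set.Ici 0)]
  · refine setIntegral_congr_fun measurableSet_Ici fun t _ => ?_
    simp only [Complex.real_smul, Real.abs_exp]
    rw [mul_left_comm]
    congr 1
    rw [Complex.ofReal_exp, Complex.cpow_def_of_ne_zero (Complex.exp_ne_zero _),
      ← Complex.ofReal_exp, ← Complex.ofReal_log (Real.exp_nonneg t), Real.log_exp,
      Complex.ofReal_exp, ← Complex.exp_add]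
    congr 1
    ring
  · intro t ht
    rw [moebiusSum_of_lt_one (Real.exp_lt_one_iff.2 (by simpa using ht)), zero_mul]

/-- Abel summation writes `1/ζ(z+1) = ∑ μ(n) n^{-1-z}` as `z` times the integral; boundedness of `M`
supplies the growth exponent `0` used there. -/
theorem integral_moebiusSum_exp {z : ℂ} (hz : 0 < z.re) :
    ∫ t : ℝ, moebiusSum (Real.exp t) * Complex.exp (-(z * t)) = (zetaMulSubOne (z + 1))⁻¹ := by
  have hz0 : z ≠ 0 := fun h => by simp [h] at hz
  have hz1 : 1 < (z + 1).re := by simpa using hz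
  have hL := LSeries_eq_mul_integral (fun n => (ArithmeticFunction.moebius n : ℂ) / n)
    le_rfl hz (LSeriesSummable_moebius_div hz) (by
      refine Asymptotics.IsBigO.of_bound 1 (Eventually.of_forall fun n => ?_)
      simpa using norm_sum_moebius_div_le n)
  have hζ := LSeries_one_mul_Lseries_moebius hz1
  rw [LSeries_one_eq_riemannZeta hz1, ← LSeries_moebius_div, hL] at hζ
  rw [integral_moebiusSum_exp_eq, zetaMulSubOne, Function.update_of_ne (by simpa using hz0)]
  refine eq_inv_of_mul_eq_one_right ?_
  simp only [moebiusSum]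
  rw [add_sub_cancel_right, mul_comm z, mul_assoc]
  exact hζ

theorem tendsto_sum_moebius_div :
    Tendsto (fun N : ℕ => ∑ k ∈ Finset.Icc 1 N, (ArithmeticFunction.moebius k : ℂ) / k)
      atTop (𝓝 0) := by
  have h := tendsto_zero_of_laplace (f := fun t => moebiusSum (Real.exp t))
    (G := fun z => (zetaMulSubOne (z + 1))⁻¹)
    (measurable_moebiusSum.comp Real.measurable_exp).aestronglyMeasurable
    (fun t => norm_moebiusSum_le _)
    (fun t ht => moebiusSum_of_lt_one (Real.exp_lt_one_iff.2 ht))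
    (ContinuousOn.inv₀ (continuous_zetaMulSubOne.comp (by fun_prop)).continuousOn
      fun z (hz : 0 ≤ z.re) => zetaMulSubOne_ne_zero (by simpa using hz))
    (fun z hz => integral_moebiusSum_exp hz) norm_moebiusSum_exp_sub_le
  refine (h.comp (Real.tendsto_log_atTop.comp tendsto_natCast_atTop_atTop)).congr' ?_
  filter_upwards [eventually_gt_atTop 0] with N hN
  simp [moebiusSum, Real.exp_log (show (0 : ℝ) < N by exact_mod_cast hN)]

end CyclotomicProduct

/-! ### Ramanujan sums. -/

namespace CyclotomicProduct

open Filter Topology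

theorem sum_exp_eq_ite {e : ℕ} (he : e ≠ 0) (m : ℕ) :
    ∑ j ∈ Finset.Icc 1 e, Complex.exp (2 * Real.pi * Complex.I * j * m / e) =
      if e ∣ m then (e : ℂ) else 0 := by
  have he' : (e : ℂ) ≠ 0 := by exact_mod_cast he
  set ω : ℂ := Complex.exp (2 * Real.pi * Complex.I * m / e) with hω
  have hpow : ∀ j : ℕ, Complex.exp (2 * Real.pi * Complex.I * j * m / e) = ω ^ j := fun j => by
    rw [hω, ← Complex.exp_nat_mul]
    congr 1
    ring
  simp_rw [hpow]
  have hωe : ω ^ e = 1 := by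
    rw [hω, ← Complex.exp_nat_mul, Complex.exp_eq_one_iff]
    refine ⟨m, ?_⟩
    push_cast
    field_simp
  have hiff : ω = 1 ↔ e ∣ m := by
    rw [hω, Complex.exp_eq_one_iff]
    constructor
    · rintro ⟨q, hq⟩
      have hpi := Complex.two_pi_I_ne_zero
      have h1 : (2 * Real.pi * Complex.I) * (m : ℂ) = (2 * Real.pi * Complex.I) * (e * q) := by
        field_simp at hq
        linear_combination (2 * Real.pi * Complex.I) * hq
      have h2 : (m : ℤ) = e * q := by exact_mod_cast mul_left_cancel₀ hpi h1
      exact Int.natCast_dvd_natCast.1 ⟨q, h2⟩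
    · rintro ⟨q, rfl⟩
      refine ⟨q, ?_⟩
      push_cast
      field_simp
  split_ifs with h
  · simp [hiff.2 h]
  · have h1 : ω ≠ 1 := fun h' => h (hiff.1 h')
    have hshift : ∑ j ∈ Finset.Icc 1 e, ω ^ j = ω * ∑ j ∈ Finset.range e, ω ^ j := by
      rw [Finset.mul_sum, Finset.range_eq_Ico, ← Finset.Ico_succ_right_eq_Icc,
        Finset.sum_Ico_eq_sum_range, Finset.sum_Ico_eq_sum_range]
      simp [pow_add]
    rw [hshift, geom_sum_eq h1, hωe]
    simp

theorem sum_dvd_exp {d e : ℕ} (hd : d ≠ 0) (m : ℕ) :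
    ∑ k ∈ Finset.Icc 1 (d * e) with d ∣ k,
        Complex.exp (2 * Real.pi * Complex.I * k * m / ((d * e : ℕ) : ℂ)) =
      ∑ j ∈ Finset.Icc 1 e, Complex.exp (2 * Real.pi * Complex.I * j * m / e) := by
  have hd' : (d : ℂ) ≠ 0 := by exact_mod_cast hd
  have hpos : 0 < d := Nat.pos_of_ne_zero hd
  symm
  refine Finset.sum_bij (fun j _ => d * j) ?_ ?_ ?_ ?_
  · intro j hj
    simp only [Finset.mem_filter, Finset.mem_Icc] at hj ⊢
    exact ⟨⟨Nat.mul_pos hpos hj.1, Nat.mul_le_mul_left d hj.2⟩, dvd_mul_right d j⟩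
  · intro a _ b _ h
    exact Nat.eq_of_mul_eq_mul_left hpos h
  · intro k hk
    simp only [Finset.mem_filter, Finset.mem_Icc] at hk
    obtain ⟨⟨h1, h2⟩, j, rfl⟩ := hk
    exact ⟨j, Finset.mem_Icc.2 ⟨Nat.pos_of_mul_pos_left h1, Nat.le_of_mul_le_mul_left h2 hpos⟩,
      rfl⟩
  · intro j _
    congr 1
    push_cast
    rw [show 2 * Real.pi * Complex.I * (d * j : ℂ) * m = d * (2 * Real.pi * Complex.I * j * m) by
      ring, mul_div_mul_left _ _ hd']

theorem sum_moebius_divisors (n : ℕ) :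
    ∑ d ∈ n.divisors, (ArithmeticFunction.moebius d : ℂ) = if n = 1 then 1 else 0 := by
  have h := congrArg (fun F : ArithmeticFunction ℤ => ((F n : ℤ) : ℂ))
    ArithmeticFunction.moebius_mul_coe_zeta
  simp only [ArithmeticFunction.coe_mul_zeta_apply, ArithmeticFunction.one_apply] at h
  push_cast at h
  exact h

/-- Coprimality is detected by `∑_{d ∣ gcd(k,n)} μ(d)`; after exchanging sums, each inner sum runs
over all `n/d`-th roots of unity. -/
theorem ramanujanSum_eq {n : ℕ} (hn : n ≠ 0) (m : ℕ) :
    ramanujanSum n m = ∑ d ∈ n.divisors,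
      (ArithmeticFunction.moebius d : ℂ) * if n / d ∣ m then ((n / d : ℕ) : ℂ) else 0 := by
  have hdiv : ∀ k, (Nat.gcd k n).divisors = n.divisors.filter (· ∣ k) := fun k => by
    ext d
    simp [Nat.dvd_gcd_iff, hn, and_comm]
  rw [ramanujanSum, residues, Finset.sum_filter]
  calc _ = ∑ k ∈ Finset.Icc 1 n, ∑ d ∈ n.divisors, if d ∣ k then
        (ArithmeticFunction.moebius d : ℂ) *
          Complex.exp (2 * Real.pi * Complex.I * k * m / n) else 0 := by
        refine Finset.sum_congr rfl fun k _ => ?_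
        rw [← Finset.sum_filter, ← hdiv, ← Finset.sum_mul, sum_moebius_divisors]
        split_ifs <;> simp
    _ = _ := by
        rw [Finset.sum_comm]
        refine Finset.sum_congr rfl fun d hd => ?_
        obtain ⟨e, rfl⟩ := Nat.dvd_of_mem_divisors hd
        have hd0 : d ≠ 0 := left_ne_zero_of_mul hn
        rw [← Finset.sum_filter, ← Finset.mul_sum, sum_dvd_exp hd0,
          Nat.mul_div_cancel_left e (Nat.pos_of_ne_zero hd0),
          sum_exp_eq_ite (right_ne_zero_of_mul hn)]

/-- The indicator function of the divisors of `m`. -/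
noncomputable def divisorIndicator (m : ℕ) : ArithmeticFunction ℂ :=
  ⟨fun e => if e ∈ m.divisors then 1 else 0, by simp⟩

/-- The arithmetic function `d ↦ μ(d) / d`. -/
noncomputable def moebiusDiv : ArithmeticFunction ℂ :=
  ⟨fun d => (ArithmeticFunction.moebius d : ℂ) / d, by simp⟩

theorem ramanujanSum_div_eq {n m : ℕ} (hn : n ≠ 0) (hm : m ≠ 0) :
    ramanujanSum n m / n = (divisorIndicator m * moebiusDiv) n := by
  have h : (divisorIndicator m * moebiusDiv) n =
      ∑ d ∈ n.divisors, divisorIndicator m (n / d) * moebiusDiv d := by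
    rw [ArithmeticFunction.mul_apply,
      Nat.sum_divisorsAntidiagonal' (fun a b => divisorIndicator m a * moebiusDiv b)]
  rw [h, ramanujanSum_eq hn, Finset.sum_div]
  refine Finset.sum_congr rfl fun d hd => ?_
  obtain ⟨e, rfl⟩ := Nat.dvd_of_mem_divisors hd
  have hd0 : d ≠ 0 := left_ne_zero_of_mul hn
  have hd1 : (d : ℂ) ≠ 0 := by exact_mod_cast hd0
  have he1 : (e : ℂ) ≠ 0 := by exact_mod_cast right_ne_zero_of_mul hn
  rw [Nat.mul_div_cancel_left e (Nat.pos_of_ne_zero hd0)]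
  simp only [divisorIndicator, moebiusDiv, ArithmeticFunction.coe_mk, Nat.mem_divisors, ne_eq, hm,
    not_false_eq_true, and_true]
  split_ifs
  · push_cast
    field_simp
  · simp

/-- Summing a Dirichlet convolution up to `N`, with the divisor `e` of `m` outermost. -/
theorem ramanujanPartialSum_eq (N : ℕ) {m : ℕ} (hm : m ≠ 0) :
    ramanujanPartialSum N m = ∑ e ∈ m.divisors,
      ∑ k ∈ Finset.Icc 1 (N / e), (ArithmeticFunction.moebius k : ℂ) / k := by
  have hI : ∀ N : ℕ, Finset.Icc 1 N = Finset.Ioc 0 N := fun N => by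
    ext; simp [Nat.succ_le_iff]
  have h1 : ramanujanPartialSum N m = ∑ n ∈ Finset.Ioc 0 N, (divisorIndicator m * moebiusDiv) n := by
    rw [ramanujanPartialSum, hI]
    refine Finset.sum_congr rfl fun n hn => ramanujanSum_div_eq ?_ hm
    have := (Finset.mem_Ioc.1 hn).1
    omega
  rw [h1, ArithmeticFunction.sum_Ioc_mul_eq_sum_sum]
  simp only [divisorIndicator, moebiusDiv, ArithmeticFunction.coe_mk, ite_mul, one_mul, zero_mul,
    hI]
  rw [← Finset.sum_filter, Finset.filter_mem_eq_inter]
  -- Divisors `e > N` contribute empty sums.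
  refine Finset.sum_subset Finset.inter_subset_right fun e he hne => ?_
  have he0 : 0 < e := Nat.pos_of_mem_divisors he
  have hlt : N < e := by
    by_contra! hle
    exact hne (Finset.mem_inter.2 ⟨Finset.mem_Ioc.2 ⟨he0, hle⟩, he⟩)
  simp [Nat.div_eq_of_lt hlt]

/-- Ramanujan's identity `∑ c_n(m) / n = 0`. -/
theorem tendsto_ramanujanPartialSum {m : ℕ} (hm : m ≠ 0) :
    Tendsto (fun N => ramanujanPartialSum N m) atTop (𝓝 0) := by
  simp_rw [fun N => ramanujanPartialSum_eq N hm]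
  rw [← Finset.sum_const_zero (s := m.divisors)]
  exact tendsto_finsetSum _ fun e he => tendsto_sum_moebius_div.comp
    (Nat.tendsto_div_const_atTop (Nat.pos_of_mem_divisors he).ne')

theorem norm_ramanujanPartialSum_le (N : ℕ) {m : ℕ} (hm : m ≠ 0) :
    ‖ramanujanPartialSum N m‖ ≤ m := by
  rw [ramanujanPartialSum_eq N hm]
  refine (norm_sum_le_of_le _ fun e _ => norm_sum_moebius_div_le (N / e)).trans ?_
  rw [Finset.sum_const, nsmul_one]
  exact_mod_cast Nat.card_divisors_le_self m

/-! ### Power series and passage to the limit. -/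

theorem hasSum_logPhiHat (n : ℕ) {z : ℂ} (hz : ‖z‖ < 1) :
    HasSum (fun m : ℕ => -(ramanujanSum n m * z ^ m / m)) (logPhiHat n z) := by
  have h : ∀ k ∈ residues n,
      HasSum (fun m : ℕ => -((z * root n k) ^ m / m)) (Complex.log (1 - z * root n k)) := by
    intro k _
    have hk : ‖z * root n k‖ < 1 := by rwa [norm_mul, norm_root, mul_one]
    simpa using (Complex.hasSum_taylorSeries_neg_log hk).neg
  refine (hasSum_sum h).congr_fun fun m => ?_
  rw [ramanujanSum, Finset.sum_mul, Finset.sum_div, ← Finset.sum_neg_distrib]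
  refine Finset.sum_congr rfl fun k _ => ?_
  have hr : root n k ^ m = Complex.exp (2 * Real.pi * Complex.I * k * m / n) := by
    rw [root, ← Complex.exp_nat_mul]
    congr 1
    ring
  rw [mul_pow, hr]
  ring

theorem hasSum_logPartialSum (N : ℕ) {z : ℂ} (hz : ‖z‖ < 1) :
    HasSum (fun m : ℕ => -(ramanujanPartialSum N m * z ^ m / m)) (logPartialSum N z) := by
  refine (hasSum_sum fun n (_ : n ∈ Finset.Icc 1 N) =>
    (hasSum_logPhiHat n hz).div_const (n : ℂ)).congr_fun fun m => ?_
  rw [ramanujanPartialSum, Finset.sum_mul, Finset.sum_div, ← Finset.sum_neg_distrib]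
  refine Finset.sum_congr rfl fun n _ => ?_
  ring

/-- A majorant free of `N`. At `m = 0` the term is `0` because division by zero gives `0`. -/
theorem norm_ramanujanPartialSum_mul_le (N m : ℕ) {r : ℝ} (hr : 0 ≤ r) :
    ‖ramanujanPartialSum N m‖ * r ^ m / m ≤ r ^ m := by
  rcases eq_or_ne m 0 with rfl | hm
  · simp
  · have hm' : (0 : ℝ) < m := by exact_mod_cast Nat.pos_of_ne_zero hm
    rw [div_le_iff₀ hm', mul_comm]
    gcongr
    exact norm_ramanujanPartialSum_le N hm

theorem tendsto_tsum_norm_ramanujanPartialSum {r : ℝ} (hr : 0 ≤ r) (hr1 : r < 1) :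
    Tendsto (fun N => ∑' m : ℕ, ‖ramanujanPartialSum N m‖ * r ^ m / m) atTop (𝓝 0) := by
  have h := tendsto_tsum_of_dominated_convergence (𝓕 := atTop)
    (f := fun (N m : ℕ) => ‖ramanujanPartialSum N m‖ * r ^ m / m) (g := fun _ => (0 : ℝ))
    (summable_geometric_of_lt_one hr hr1) (fun m => ?_) (Eventually.of_forall fun N m => ?_)
  · simpa using h
  · rcases eq_or_ne m 0 with rfl | hm
    · simp
    · simpa using ((tendsto_ramanujanPartialSum hm).norm.mul_const (r ^ m)).div_const (m : ℝ)
  · rw [Real.norm_of_nonneg (by positivity)]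
    exact norm_ramanujanPartialSum_mul_le N m hr

theorem norm_logPartialSum_le (N : ℕ) {r : ℝ} (hr1 : r < 1) {z : ℂ} (hz : ‖z‖ ≤ r) :
    ‖logPartialSum N z‖ ≤ ∑' m : ℕ, ‖ramanujanPartialSum N m‖ * r ^ m / m := by
  have hr : 0 ≤ r := (norm_nonneg z).trans hz
  rw [← (hasSum_logPartialSum N (hz.trans_lt hr1)).tsum_eq]
  refine tsum_of_norm_bounded (Summable.hasSum ?_) fun m => ?_
  · exact Summable.of_nonneg_of_le (fun m => by positivity)
      (fun m => norm_ramanujanPartialSum_mul_le N m hr) (summable_geometric_of_lt_one hr hr1)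
  · rw [norm_neg, norm_div, norm_mul, norm_pow, Complex.norm_natCast]
    gcongr

theorem tendstoLocallyUniformlyOn_logPartialSum :
    TendstoLocallyUniformlyOn logPartialSum (fun _ : ℂ => (0 : ℂ)) atTop (Metric.ball 0 1) := by
  rw [Metric.tendstoLocallyUniformlyOn_iff]
  intro ε hε x hx
  obtain ⟨r, hxr, hr1⟩ := exists_between (mem_ball_zero_iff.1 hx)
  refine ⟨Metric.ball 0 r, mem_nhdsWithin_of_mem_nhds
    (Metric.isOpen_ball.mem_nhds (mem_ball_zero_iff.2 hxr)), ?_⟩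
  filter_upwards [(tendsto_tsum_norm_ramanujanPartialSum
    ((norm_nonneg x).trans hxr.le) hr1).eventually_lt_const hε] with N hN y hy
  rw [dist_zero_left]
  exact (norm_logPartialSum_le N hr1 (mem_ball_zero_iff.1 hy).le).trans_lt hN

/-- The factor `1/(z-1) = -exp(-log(1-z))` at `n = 1` carries the sign that the leading minus
cancels; for `N = 0` this factor is absent and the identity fails. -/
theorem partialProduct_eq_exp {N : ℕ} (hN : 1 ≤ N) {z : ℂ} (hz : ‖z‖ < 1) :
    partialProduct N z = Complex.exp (-logPartialSum N z) := by
  have h1 : ∀ n, cyclotomicFactor n z =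
      (if n = 1 then -1 else 1) * Complex.exp (-(logPhiHat n z / n)) := by
    intro n
    rw [cyclotomicFactor]
    split_ifs with h
    · subst h
      have hexp := exp_logPhiHat 1 hz
      rw [phiHat_one] at hexp
      rw [Nat.cast_one, div_one, Complex.exp_neg, hexp, Polynomial.cyclotomic_one]
      simp only [Polynomial.eval_sub, Polynomial.eval_X, Polynomial.eval_one]
      rw [← neg_sub 1 z, inv_neg, neg_one_mul]
    · rw [one_mul]
  rw [partialProduct, Finset.prod_congr rfl fun n _ => h1 n, Finset.prod_mul_distrib,
    Finset.prod_ite_eq' , if_pos (Finset.mem_Icc.2 ⟨le_rfl, hN⟩), ← Complex.exp_sum,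
    Finset.sum_neg_distrib, logPartialSum]
  ring

theorem tendstoLocallyUniformlyOn_partialProduct :
    TendstoLocallyUniformlyOn partialProduct (fun _ : ℂ => (1 : ℂ)) atTop (Metric.ball 0 1) := by
  have h := tendstoLocallyUniformlyOn_logPartialSum
  rw [Metric.tendstoLocallyUniformlyOn_iff] at h ⊢
  intro ε hε x hx
  -- Chosen for `|e^w - 1| ≤ 2|w|`, valid when `|w| ≤ 1`.
  obtain ⟨t, ht, hlim⟩ := h (min 1 (ε / 2)) (by positivity) x hx
  refine ⟨t ∩ Metric.ball 0 1, inter_mem ht self_mem_nhdsWithin, ?_⟩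
  filter_upwards [hlim, eventually_ge_atTop 1] with N hN hN1 y hy
  have hlog := hN y hy.1
  rw [dist_zero_left, lt_min_iff] at hlog
  rw [partialProduct_eq_exp hN1 (mem_ball_zero_iff.1 hy.2), dist_comm, dist_eq_norm]
  refine (Complex.norm_exp_sub_one_le (by simpa using hlog.1.le)).trans_lt ?_
  rw [norm_neg]
  linarith [hlog.2]

end CyclotomicProduct

theorem theorem1p1 :
    -- the infinite product is identically `1` on the open unit disk
    TendstoLocallyUniformlyOn CyclotomicProduct.partialProduct (fun _ : ℂ => (1 : ℂ))
      Filter.atTop (Metric.ball (0 : ℂ) 1) ∧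
    -- the logarithmic series vanishes on the open unit disk
    TendstoLocallyUniformlyOn CyclotomicProduct.logPartialSum (fun _ : ℂ => (0 : ℂ))
      Filter.atTop (Metric.ball (0 : ℂ) 1) ∧
    -- the product identity, the logarithmic identity and Ramanujan's identity are equivalent
    List.TFAE [
      ∀ z : ℂ, ‖z‖ < 1 → Filter.Tendsto (fun N : ℕ => CyclotomicProduct.partialProduct N z)
        Filter.atTop (nhds 1),
      ∀ z : ℂ, ‖z‖ < 1 → Filter.Tendsto (fun N : ℕ => CyclotomicProduct.logPartialSum N z)
        Filter.atTop (nhds 0),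
      ∀ m : ℕ, 1 ≤ m → Filter.Tendsto (fun N : ℕ => CyclotomicProduct.ramanujanPartialSum N m)
        Filter.atTop (nhds 0)] := by
  have hP := CyclotomicProduct.tendstoLocallyUniformlyOn_partialProduct
  have hL := CyclotomicProduct.tendstoLocallyUniformlyOn_logPartialSum
  refine ⟨hP, hL, ?_⟩
  have ha : ∀ z : ℂ, ‖z‖ < 1 → Filter.Tendsto
      (fun N : ℕ => CyclotomicProduct.partialProduct N z) Filter.atTop (nhds 1) :=
    fun z hz => hP.tendsto_at (mem_ball_zero_iff.2 hz)
  have hb : ∀ z : ℂ, ‖z‖ < 1 → Filter.Tendsto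
      (fun N : ℕ => CyclotomicProduct.logPartialSum N z) Filter.atTop (nhds 0) :=
    fun z hz => hL.tendsto_at (mem_ball_zero_iff.2 hz)
  have hc : ∀ m : ℕ, 1 ≤ m → Filter.Tendsto
      (fun N : ℕ => CyclotomicProduct.ramanujanPartialSum N m) Filter.atTop (nhds 0) :=
    fun m hm => CyclotomicProduct.tendsto_ramanujanPartialSum (by omega)
  -- The equivalences hold because all three statements have been established.
  tfae_have 1 ↔ 2 := iff_of_true ha hb
  tfae_have 2 ↔ 3 := iff_of_true hb hc
  tfae_finish
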